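/- Let $(X,\|\cdot\|)$ be a Banach space, $a<b$ real numbers, $0<\alpha<1$, $0<\beta<1$, $f\in C^{1}([a,b],X)$, let $m\ge 1$ be an integer, and let $n\ge 1$ be an integer with $n^{1-\beta}>2$ and $\lceil na\rceil\le\lfloor nb\rfloor$. Put $$\varphi(x)=\frac{x}{\sqrt[2m]{1+x^{2m}}},\qquad \Phi(x)=\tfrac14\left[\varphi(x+1)-\varphi(x-1)\right],\qquad A_n(f,x)=\frac{\sum_{k=\lceil na\rceil}^{\lfloor nb\rfloor} f\left(\frac kn\right)\Phi(nx-k)}{\sum_{k=\lceil na\rceil}^{\lfloor nb\rfloor}\Phi(nx-k)}\quad(x\in[a,b]).$$ For $x\in[a,b]$ define the left and right Caputo–Bochner derivatives of order $\alpha$ based at $x$ by $$(D_{*x}^{\alpha}f)(y)=\frac{1}{\Gamma(1-\alpha)}\int_x^y (y-t)^{-\alpha}f'(t)\,dt\quad(y\in[x,b]),\qquad (D_{x-}^{\alpha}f)(y)=\frac{-1}{\Gamma(1-\alpha)}\int_y^x (z-y)^{-\alpha}f'(z)\,dz\quad(y\in[a,x]).$$ For an interval $S$, a function $g:S\to X$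 and $\delta>0$ write $\|g\|_{\infty,S}=\sup_{y\in S}\|g(y)\|$ and $\omega_1(g,\delta)_S=\sup\{\|g(y)-g(z)\|: y,z\in S,\ |y-z|\le\delta\}$. Then all the suprema below are finite, and (i) for every $x\in[a,b]$, $$\|A_n(f,x)-f(x)\|\le\frac{2\sqrt[2m]{1+4^m}}{\Gamma(\alpha+1)}\left\{\frac{\omega_1\left(D_{x-}^{\alpha}f,\frac1{n^\beta}\right)_{[a,x]}+\omega_1\left(D_{*x}^{\alpha}f,\frac1{n^\beta}\right)_{[x,b]}}{n^{\alpha\beta}}+\frac{\|D_{x-}^{\alpha}f\|_{\infty,[a,x]}(x-a)^\alpha+\|D_{*x}^{\alpha}f\|_{\infty,[x,b]}(b-x)^\alpha}{4m\,(n^{1-\beta}-2)^{2m}}\right\};$$ (ii) $$\|A_nf-f\|_{\infty,[a,b]}\le\frac{2\sqrt[2m]{1+4^m}}{\Gamma(\alpha+1)}\left\{\frac{\sup_{x\in[a,b]}\omega_1\left(D_{x-}^{\alpha}f,\frac1{n^\beta}\right)_{[a,x]}+\sup_{x\in[a,b]}\omega_1\left(D_{*x}^{\alpha}f,\frac1{n^\beta}\right)_{[x,b]}}{n^{\alpha\beta}}+\frac{(b-a)^\alpha}{4m\,(n^{1-\beta}-2)^{2m}}\left(\sup_{x\in[a,b]}\|D_{x-}^{\alpha}f\|_{\infty,[a,x]}+\sup_{x\in[a,b]}\|D_{*x}^{\alpha}f\|_{\infty,[x,b]}\right)\right\}.$$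 -/

import Mathlib

namespace AlgNN

noncomputable section

/-- The algebraic sigmoid `φ(x) = x / (1 + x^(2m))^(1/(2m))`. -/
def sigmoid (m : ℕ) (x : ℝ) : ℝ :=
  x / (1 + x ^ (2 * m)) ^ (1 / (2 * (m : ℝ)))

/-- The density `Φ(x) = (φ(x+1) - φ(x-1)) / 4`. -/
def density (m : ℕ) (x : ℝ) : ℝ :=
  (1 / 4) * (sigmoid m (x + 1) - sigmoid m (x - 1))

variable {X : Type*} [NormedAddCommGroup X] [NormedSpace ℝ X]

/-- The neural network operator `A_n(f, x)` on `[a, b]`; it is meant for `⌈na⌉ ≤ ⌊nb⌋`. -/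
def netOp (m : ℕ) (a b : ℝ) (n : ℕ) (f : ℝ → X) (x : ℝ) : X :=
  (∑ k ∈ Finset.Icc ⌈(n : ℝ) * a⌉ ⌊(n : ℝ) * b⌋, density m ((n : ℝ) * x - (k : ℝ)))⁻¹ •
    ∑ k ∈ Finset.Icc ⌈(n : ℝ) * a⌉ ⌊(n : ℝ) * b⌋,
      density m ((n : ℝ) * x - (k : ℝ)) • f ((k : ℝ) / (n : ℝ))

/-- Left Caputo-Bochner derivative `(D_{*x₀}^α f)(y)`, for `a ≤ x₀ ≤ y ≤ b` and non-integer
`α > 0`, of a function `f` on `[a, b]`; here `N = ⌈α⌉`. -/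
def leftCaputo (a b α : ℝ) (f : ℝ → X) (x₀ y : ℝ) : X :=
  (1 / Real.Gamma ((⌈α⌉₊ : ℝ) - α)) •
    ∫ t in x₀..y, ((y - t) ^ ((⌈α⌉₊ : ℝ) - α - 1)) •
      iteratedDerivWithin ⌈α⌉₊ f (Set.Icc a b) t

/-- Right Caputo-Bochner derivative `(D_{x₀-}^α f)(y)`, for `a ≤ y ≤ x₀ ≤ b` and non-integer
`α > 0`, of a function `f` on `[a, b]`; here `N = ⌈α⌉`. -/
def rightCaputo (a b α : ℝ) (f : ℝ → X) (x₀ y : ℝ) : X :=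
  ((-1 : ℝ) ^ ⌈α⌉₊ / Real.Gamma ((⌈α⌉₊ : ℝ) - α)) •
    ∫ z in y..x₀, ((z - y) ^ ((⌈α⌉₊ : ℝ) - α - 1)) •
      iteratedDerivWithin ⌈α⌉₊ f (Set.Icc a b) z

/-- The set of values `‖g y‖`, `y ∈ S`. -/
def normValues (g : ℝ → X) (S : Set ℝ) : Set ℝ :=
  {r | ∃ y ∈ S, r = ‖g y‖}

/-- The supremum norm of `g` over `S`. -/
def supNorm (g : ℝ → X) (S : Set ℝ) : ℝ := sSup (normValues g S)

/-- The set of values `‖g y - g z‖` with `y, z ∈ S` and `|y - z| ≤ δ`. -/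
def oscValues (g : ℝ → X) (δ : ℝ) (S : Set ℝ) : Set ℝ :=
  {r | ∃ y ∈ S, ∃ z ∈ S, |y - z| ≤ δ ∧ r = ‖g y - g z‖}

/-- The first modulus of continuity `ω₁(g, δ)` over `S`. -/
def modulus (g : ℝ → X) (δ : ℝ) (S : Set ℝ) : ℝ := sSup (oscValues g δ S)

end

end AlgNN

open AlgNN

/-!
Since `D^α f` is the fractional integral of order `1 - α` of `f'`, the semigroup law for fractional
integrals gives `f y - f x = I^α (D_{*x}^α f) y` for `y ≥ x`, and the reflection `t ↦ -t` transfers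
this to `D_{x-}^α f` for `y ≤ x`. As `D_{*x}^α f` vanishes at `x`, its norm on `[x, y]` is at most
its modulus of continuity whenever `y - x ≤ δ`, and at most its supremum norm always.

The sum of `Φ(z - k)` over consecutive integers telescopes, so its total is at most `1`, while its
tails `|z - k| ≥ s + 1` are controlled by `1 - φ(s)`, which Bernoulli's inequality bounds.
Subadditivity of `φ` on `[0, ∞)` gives `Φ ≥ φ(2) / 4` on `[-1, 1]`, which bounds the normalising
denominator from below. As `A_n(f, x)` is a weighted mean of the `f (k / n)`, it remains to split
the nodes into those within `δ` of `x` and the two tails.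
-/

namespace AlgNN

open MeasureTheory Set ProbabilityTheory

variable {X : Type*} [NormedAddCommGroup X] [NormedSpace ℝ X]

section FractionalIntegral

variable {α β x y : ℝ}

theorem integral_rpow_mul_sub_rpow (hα : 0 < α) (hβ : 0 < β) {c : ℝ} (hc : 0 < c) :
    ∫ s in 0..c, s ^ (α - 1) * (c - s) ^ (β - 1) = c ^ (α + β - 1) * beta α β := by
  have hcongr : ∫ s in 0..c, ((s ^ (α - 1) * (c - s) ^ (β - 1) : ℝ) : ℂ)
      = ∫ s in 0..c, (s : ℂ) ^ ((α : ℂ) - 1) * ((c : ℂ) - s) ^ ((β : ℂ) - 1) := by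
    refine intervalIntegral.integral_congr fun s hs => ?_
    rw [uIcc_of_le hc.le] at hs
    push_cast [Complex.ofReal_cpow hs.1, Complex.ofReal_cpow (sub_nonneg.2 hs.2)]
    rfl
  have hbeta : Complex.betaIntegral α β = beta α β := by
    rw [Complex.betaIntegral_eq_Gamma_mul_div _ _ (by simpa using hα) (by simpa using hβ), beta]
    push_cast [← Complex.Gamma_ofReal]
    rfl
  rw [Complex.betaIntegral_scaled _ _ hc, hbeta, intervalIntegral.integral_ofReal] at hcongr
  apply Complex.ofReal_injective
  push_cast [hcongr, Complex.ofReal_cpow hc.le]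
  rfl

theorem integral_sub_rpow_mul_sub_rpow (hα : 0 < α) (hβ : 0 < β) (hxy : x < y) :
    ∫ s in x..y, (y - s) ^ (α - 1) * (s - x) ^ (β - 1) = (y - x) ^ (α + β - 1) * beta α β := by
  rw [← integral_rpow_mul_sub_rpow hα hβ (sub_pos.2 hxy), ← sub_self y,
    ← intervalIntegral.integral_comp_sub_left]
  simp only [sub_sub_sub_cancel_left]

theorem intervalIntegrable_sub_rpow_mul_sub_rpow (hα : 0 < α) (hβ : 0 < β) (hxy : x < y) :
    IntervalIntegrable (fun s => (y - s) ^ (α - 1) * (s - x) ^ (β - 1)) volume x y := by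
  refine intervalIntegral.intervalIntegrable_of_integral_ne_zero ?_
  rw [integral_sub_rpow_mul_sub_rpow hα hβ hxy]
  exact (mul_pos (Real.rpow_pos_of_pos (sub_pos.2 hxy) _) (beta_pos hα hβ)).ne'

theorem intervalIntegrable_sub_rpow (hα : 0 < α) (x y : ℝ) :
    IntervalIntegrable (fun s => (y - s) ^ (α - 1)) volume x y := by
  simpa using (intervalIntegral.intervalIntegrable_rpow' (r := α - 1) (by linarith)
    (a := y - x) (b := y - y)).comp_sub_left y

theorem integral_sub_rpow (hα : 0 < α) (x y : ℝ) :
    ∫ s in x..y, (y - s) ^ (α - 1) = (y - x) ^ α / α := by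
  rw [intervalIntegral.integral_comp_sub_left (fun s => s ^ (α - 1)),
    integral_rpow (Or.inl (by linarith)), sub_self, sub_add_cancel, Real.zero_rpow hα.ne', sub_zero]

/-- The Riemann–Liouville fractional integral `(I_{x+}^α g)(y)`, meant for `0 < α` and `x ≤ y`. -/
noncomputable def fracIntegral (α : ℝ) (g : ℝ → X) (x y : ℝ) : X :=
  (1 / Real.Gamma α) • ∫ t in x..y, (y - t) ^ (α - 1) • g t

theorem fracIntegral_one (g : ℝ → X) (x y : ℝ) : fracIntegral 1 g x y = ∫ t in x..y, g t := by
  simp [fracIntegral]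

theorem norm_fracIntegral_le (hα : 0 < α) (hxy : x ≤ y) {g : ℝ → X} {C : ℝ}
    (hC : ∀ t ∈ Icc x y, ‖g t‖ ≤ C) :
    ‖fracIntegral α g x y‖ ≤ C * (y - x) ^ α / Real.Gamma (α + 1) := by
  have : 0 < Real.Gamma α := Real.Gamma_pos_of_pos hα
  have hint : ‖∫ t in x..y, (y - t) ^ (α - 1) • g t‖ ≤ ∫ t in x..y, (y - t) ^ (α - 1) * C := by
    refine intervalIntegral.norm_integral_le_of_norm_le hxy (.of_forall fun t ht => ?_)
      ((intervalIntegrable_sub_rpow hα x y).mul_const _)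
    have hker : 0 ≤ (y - t) ^ (α - 1) := Real.rpow_nonneg (sub_nonneg.2 ht.2) _
    rw [norm_smul, Real.norm_of_nonneg hker]
    exact mul_le_mul_of_nonneg_left (hC t (Ioc_subset_Icc_self ht)) hker
  calc ‖fracIntegral α g x y‖
      = 1 / Real.Gamma α * ‖∫ t in x..y, (y - t) ^ (α - 1) • g t‖ := by
        rw [fracIntegral, norm_smul, Real.norm_of_nonneg (by positivity)]
    _ ≤ 1 / Real.Gamma α * ∫ t in x..y, (y - t) ^ (α - 1) * C := by gcongr
    _ = C * (y - x) ^ α / Real.Gamma (α + 1) := by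
        rw [intervalIntegral.integral_mul_const, integral_sub_rpow hα,
          Real.Gamma_add_one hα.ne']
        field_simp

theorem Ioc_inter_Ici_of_lt {t : ℝ} (h : x < t) : Ioc x y ∩ Ici t = Icc t y := by
  rw [← Ioi_inter_Iic, inter_right_comm, inter_eq_right.2 (Ici_subset_Ioi.2 h), Ici_inter_Iic]

theorem setIntegral_Ioc_indicator_Ici {t : ℝ} (ht : t ∈ Ioc x y) (G : ℝ → X) :
    ∫ s in Ioc x y, (Ici t).indicator G s = ∫ s in t..y, G s := by
  rw [setIntegral_indicator measurableSet_Ici, Ioc_inter_Ici_of_lt ht.1,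
    integral_Icc_eq_integral_Ioc, intervalIntegral.integral_of_le ht.2]

theorem setIntegral_Ioc_indicator_Iic {s : ℝ} (hs : s ∈ Ioc x y) (G : ℝ → X) :
    ∫ t in Ioc x y, (Iic s).indicator G t = ∫ t in x..s, G t := by
  rw [setIntegral_indicator measurableSet_Iic, Ioc_inter_Iic, min_eq_right hs.2,
    intervalIntegral.integral_of_le hs.1.le]

theorem integrableOn_Ioc_indicator_Ici {t : ℝ} (ht : t ∈ Ioc x y) {G : ℝ → ℝ}
    (hG : IntervalIntegrable G volume t y) : IntegrableOn ((Ici t).indicator G) (Ioc x y) := by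
  rw [integrableOn_indicator_iff measurableSet_Ici, inter_comm, Ioc_inter_Ici_of_lt ht.1,
    ← intervalIntegrable_iff_integrableOn_Icc_of_le ht.2]
  exact hG

theorem integral_integral_swap_triangle (hxy : x ≤ y) {F : ℝ → ℝ → X}
    (hF : IntegrableOn ({p : ℝ × ℝ | p.2 ≤ p.1}.indicator F.uncurry) (Ioc x y ×ˢ Ioc x y)) :
    ∫ s in x..y, ∫ t in x..s, F s t = ∫ t in x..y, ∫ s in t..y, F s t := by
  rw [IntegrableOn, Measure.volume_eq_prod, ← Measure.prod_restrict] at hF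
  rw [intervalIntegral.integral_of_le hxy, intervalIntegral.integral_of_le hxy]
  calc ∫ s in Ioc x y, ∫ t in x..s, F s t
      = ∫ s in Ioc x y, ∫ t in Ioc x y, (Iic s).indicator (F s) t :=
        setIntegral_congr_fun measurableSet_Ioc fun s hs =>
          (setIntegral_Ioc_indicator_Iic hs (F s)).symm
    _ = ∫ t in Ioc x y, ∫ s in Ioc x y, (Ici t).indicator (F · t) s := integral_integral_swap hF
    _ = ∫ t in Ioc x y, ∫ s in t..y, F s t :=
        setIntegral_congr_fun measurableSet_Ioc fun t ht => setIntegral_Ioc_indicator_Ici ht (F · t)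

theorem integrableOn_triangle_sub_rpow_mul_sub_rpow (hα : 0 < α) (hβ : 0 < β) (x y : ℝ) :
    IntegrableOn ({p : ℝ × ℝ | p.2 ≤ p.1}.indicator
      fun p => (y - p.1) ^ (α - 1) * (p.1 - p.2) ^ (β - 1)) (Ioc x y ×ˢ Ioc x y) := by
  set K := {p : ℝ × ℝ | p.2 ≤ p.1}.indicator
    fun p => (y - p.1) ^ (α - 1) * (p.1 - p.2) ^ (β - 1)
  have hmeas : Measurable K :=
    Measurable.indicator (by fun_prop) (measurableSet_le measurable_snd measurable_fst)
  have hsection : ∀ t, (fun s => K (s, t))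
      = (Ici t).indicator fun s => (y - s) ^ (α - 1) * (s - t) ^ (β - 1) := fun _ => rfl
  have hnonneg : ∀ t, ∀ s ∈ Ioc x y, 0 ≤ K (s, t) := fun t s hs =>
    indicator_apply_nonneg fun hts => mul_nonneg (Real.rpow_nonneg (sub_nonneg.2 hs.2) _)
      (Real.rpow_nonneg (sub_nonneg.2 hts) _)
  have hae : ∀ᵐ t ∂volume.restrict (Ioc x y), t ∈ Ioo x y := by
    rw [← restrict_Ioo_eq_restrict_Ioc]
    exact ae_restrict_mem measurableSet_Ioo
  rw [IntegrableOn, Measure.volume_eq_prod, ← Measure.prod_restrict,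
    integrable_prod_iff' hmeas.aestronglyMeasurable]
  constructor
  · filter_upwards [hae] with t ht
    rw [hsection]
    exact integrableOn_Ioc_indicator_Ici (Ioo_subset_Ioc_self ht)
      (intervalIntegrable_sub_rpow_mul_sub_rpow hα hβ ht.2)
  · refine Integrable.congr (((intervalIntegrable_sub_rpow (add_pos hα hβ) x y).1).mul_const
      (beta α β)) ?_
    filter_upwards [hae] with t ht
    rw [← integral_sub_rpow_mul_sub_rpow hα hβ ht.2,
      ← setIntegral_Ioc_indicator_Ici (Ioo_subset_Ioc_self ht), ← hsection]
    exact setIntegral_congr_fun measurableSet_Ioc fun s hs =>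
      (Real.norm_of_nonneg (hnonneg t s hs)).symm

theorem integrableOn_triangle_sub_rpow_mul_sub_rpow_smul (hα : 0 < α) (hβ : 0 < β) {g : ℝ → X}
    (hg : ContinuousOn g (Icc x y)) :
    IntegrableOn ({p : ℝ × ℝ | p.2 ≤ p.1}.indicator (Function.uncurry
      fun s t => ((y - s) ^ (α - 1) * (s - t) ^ (β - 1)) • g t)) (Ioc x y ×ˢ Ioc x y) := by
  obtain ⟨M, hM⟩ := isCompact_Icc.exists_bound_of_continuousOn hg
  have hg_meas : AEStronglyMeasurable g (volume.restrict (Ioc x y)) :=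
    (hg.mono Ioc_subset_Icc_self).aestronglyMeasurable measurableSet_Ioc
  have hg_bound : ∀ᵐ p ∂volume.restrict (Ioc x y ×ˢ Ioc x y), ‖g p.2‖ ≤ M := by
    filter_upwards [ae_restrict_mem (measurableSet_Ioc.prod measurableSet_Ioc)] with p hp
    exact hM p.2 (Ioc_subset_Icc_self hp.2)
  have hker := integrableOn_triangle_sub_rpow_mul_sub_rpow hα hβ x y
  rw [IntegrableOn] at hker ⊢
  change Integrable ({p : ℝ × ℝ | p.2 ≤ p.1}.indicator fun p => _ • g p.2) _
  rw [indicator_smul_left]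
  refine hker.smul_bdd M ?_ hg_bound
  rw [Measure.volume_eq_prod, ← Measure.prod_restrict]
  exact hg_meas.comp_snd

/-- Fubini on the triangle `x ≤ t ≤ s ≤ y` reduces the semigroup law to Euler's beta integral. -/
theorem fracIntegral_fracIntegral [CompleteSpace X] (hα : 0 < α) (hβ : 0 < β) (hxy : x ≤ y)
    {g : ℝ → X} (hg : ContinuousOn g (Icc x y)) :
    fracIntegral α (fracIntegral β g x) x y = fracIntegral (α + β) g x y := by
  have hΓα := (Real.Gamma_pos_of_pos hα).ne'
  have hΓβ := (Real.Gamma_pos_of_pos hβ).ne'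
  have hinner : ∀ t ∈ Ioo x y, ∫ s in t..y, ((y - s) ^ (α - 1) * (s - t) ^ (β - 1)) • g t
      = (beta α β * (y - t) ^ (α + β - 1)) • g t := fun t ht => by
    rw [intervalIntegral.integral_smul_const, integral_sub_rpow_mul_sub_rpow hα hβ ht.2, mul_comm]
  have hfubini : ∫ s in x..y, (y - s) ^ (α - 1) • ∫ t in x..s, (s - t) ^ (β - 1) • g t
      = beta α β • ∫ t in x..y, (y - t) ^ (α + β - 1) • g t := by
    simp only [← intervalIntegral.integral_smul, smul_smul]
    rw [integral_integral_swap_triangle hxy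
      (integrableOn_triangle_sub_rpow_mul_sub_rpow_smul hα hβ hg)]
    simp only [intervalIntegral.integral_of_le hxy, integral_Ioc_eq_integral_Ioo]
    exact setIntegral_congr_fun measurableSet_Ioo hinner
  simp only [fracIntegral, smul_comm _ (1 / Real.Gamma β), intervalIntegral.integral_smul]
  rw [hfubini, smul_smul, smul_smul, beta]
  congr 1
  field_simp

end FractionalIntegral

section Suprema

variable {E : Type*} [NormedAddCommGroup E] {g : ℝ → E} {S : Set ℝ} {B δ : ℝ}

theorem bddAbove_normValues (hB : ∀ y ∈ S, ‖g y‖ ≤ B) : BddAbove (normValues g S) :=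
  ⟨B, by rintro _ ⟨y, hy, rfl⟩; exact hB y hy⟩

theorem norm_sub_le_of_mem_oscValues (hB : ∀ y ∈ S, ‖g y‖ ≤ B) :
    ∀ r ∈ oscValues g δ S, r ≤ B + B := by
  rintro _ ⟨y, hy, z, hz, -, rfl⟩
  exact norm_sub_le_of_le (hB y hy) (hB z hz)

theorem bddAbove_oscValues (hB : ∀ y ∈ S, ‖g y‖ ≤ B) : BddAbove (oscValues g δ S) :=
  ⟨B + B, norm_sub_le_of_mem_oscValues hB⟩

theorem supNorm_nonneg (g : ℝ → E) (S : Set ℝ) : 0 ≤ supNorm g S :=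
  Real.sSup_nonneg (by rintro _ ⟨y, -, rfl⟩; exact norm_nonneg _)

theorem modulus_nonneg (g : ℝ → E) (δ : ℝ) (S : Set ℝ) : 0 ≤ modulus g δ S :=
  Real.sSup_nonneg (by rintro _ ⟨y, -, z, -, -, rfl⟩; exact norm_nonneg _)

theorem supNorm_le (hB₀ : 0 ≤ B) (hB : ∀ y ∈ S, ‖g y‖ ≤ B) : supNorm g S ≤ B :=
  Real.sSup_le (by rintro _ ⟨y, hy, rfl⟩; exact hB y hy) hB₀

theorem modulus_le (hB₀ : 0 ≤ B) (hB : ∀ y ∈ S, ‖g y‖ ≤ B) : modulus g δ S ≤ B + B :=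
  Real.sSup_le (norm_sub_le_of_mem_oscValues hB) (add_nonneg hB₀ hB₀)

theorem norm_le_supNorm (hg : BddAbove (normValues g S)) {y : ℝ} (hy : y ∈ S) :
    ‖g y‖ ≤ supNorm g S :=
  le_csSup hg ⟨y, hy, rfl⟩

theorem norm_sub_le_modulus (hg : BddAbove (oscValues g δ S)) {y z : ℝ} (hy : y ∈ S)
    (hz : z ∈ S) (hyz : |y - z| ≤ δ) : ‖g y - g z‖ ≤ modulus g δ S :=
  le_csSup hg ⟨y, hy, z, hz, hyz, rfl⟩

theorem normValues_comp_neg (g : ℝ → E) (S : Set ℝ) :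
    normValues (fun y => g (-y)) (-S) = normValues g S := by
  ext r
  constructor
  · rintro ⟨y, hy, rfl⟩
    exact ⟨-y, hy, rfl⟩
  · rintro ⟨y, hy, rfl⟩
    exact ⟨-y, neg_mem_neg.2 hy, by simp only [neg_neg]⟩

theorem oscValues_comp_neg (g : ℝ → E) (δ : ℝ) (S : Set ℝ) :
    oscValues (fun y => g (-y)) δ (-S) = oscValues g δ S := by
  ext r
  constructor
  · rintro ⟨y, hy, z, hz, hyz, rfl⟩
    exact ⟨-y, hy, -z, hz, by rwa [neg_sub_neg, abs_sub_comm], rfl⟩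
  · rintro ⟨y, hy, z, hz, hyz, rfl⟩
    exact ⟨-y, neg_mem_neg.2 hy, -z, neg_mem_neg.2 hz, by rwa [neg_sub_neg, abs_sub_comm],
      by simp only [neg_neg]⟩

theorem supNorm_comp_neg (g : ℝ → E) (S : Set ℝ) : supNorm (fun y => g (-y)) (-S) = supNorm g S :=
  congrArg sSup (normValues_comp_neg g S)

theorem modulus_comp_neg (g : ℝ → E) (δ : ℝ) (S : Set ℝ) :
    modulus (fun y => g (-y)) δ (-S) = modulus g δ S :=
  congrArg sSup (oscValues_comp_neg g δ S)

end Suprema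

section Caputo

variable {a b α : ℝ} {f : ℝ → X}

theorem leftCaputo_eq_fracIntegral (a b α : ℝ) (f : ℝ → X) (x : ℝ) :
    leftCaputo a b α f x
      = fracIntegral (⌈α⌉₊ - α) (iteratedDerivWithin ⌈α⌉₊ f (Icc a b)) x :=
  rfl

theorem leftCaputo_comp_neg (a b α : ℝ) (f : ℝ → X) (x : ℝ) :
    leftCaputo (-b) (-a) α (fun t => f (-t)) (-x) = fun y => rightCaputo a b α f x (-y) := by
  funext y
  have hsubst := intervalIntegral.integral_comp_neg (a := -x) (b := y) fun z =>
    (z - -y) ^ ((⌈α⌉₊ : ℝ) - α - 1) • iteratedDerivWithin ⌈α⌉₊ f (Icc a b) z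
  simp only [neg_neg, neg_sub_neg] at hsubst
  simp only [rightCaputo, leftCaputo, iteratedDerivWithin_comp_neg, neg_Icc, neg_neg, ← hsubst]
  simp only [smul_comm _ ((-1 : ℝ) ^ ⌈α⌉₊), intervalIntegral.integral_smul]
  rw [smul_smul, mul_one_div]

theorem leftCaputo_self (x : ℝ) : leftCaputo a b α f x x = 0 := by
  simp only [leftCaputo, intervalIntegral.integral_same, smul_zero]

theorem contDiffOn_comp_neg_Icc {N : WithTop ℕ∞} (hf : ContDiffOn ℝ N f (Icc a b)) :
    ContDiffOn ℝ N (fun t => f (-t)) (Icc (-b) (-a)) :=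
  hf.comp contDiff_neg.contDiffOn fun _ ht => ⟨le_neg.1 ht.2, neg_le.1 ht.1⟩

theorem exists_norm_leftCaputo_le (hab : a < b) (hα : α < ⌈α⌉₊)
    (hf : ContDiffOn ℝ ⌈α⌉₊ f (Icc a b)) :
    ∃ B, 0 ≤ B ∧ ∀ x ∈ Icc a b, ∀ y ∈ Icc x b, ‖leftCaputo a b α f x y‖ ≤ B := by
  obtain ⟨M, hM⟩ := isCompact_Icc.exists_bound_of_continuousOn
    (hf.continuousOn_iteratedDerivWithin le_rfl (uniqueDiffOn_Icc hab))
  have hM₀ : 0 ≤ M := (norm_nonneg _).trans (hM a (left_mem_Icc.2 hab.le))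
  have hα' : 0 < ⌈α⌉₊ - α := sub_pos.2 hα
  have : 0 < Real.Gamma (⌈α⌉₊ - α + 1) := Real.Gamma_pos_of_pos (by linarith)
  have : 0 < b - a := sub_pos.2 hab
  refine ⟨M * (b - a) ^ (⌈α⌉₊ - α) / Real.Gamma (⌈α⌉₊ - α + 1), by positivity,
    fun x hx y hy => ?_⟩
  rw [leftCaputo_eq_fracIntegral]
  refine (norm_fracIntegral_le hα' hy.1 fun t ht =>
    hM t ⟨hx.1.trans ht.1, ht.2.trans hy.2⟩).trans ?_
  have : 0 ≤ y - x := sub_nonneg.2 hy.1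
  gcongr
  exacts [hy.2, hx.1]

theorem exists_norm_rightCaputo_le (hab : a < b) (hα : α < ⌈α⌉₊)
    (hf : ContDiffOn ℝ ⌈α⌉₊ f (Icc a b)) :
    ∃ B, 0 ≤ B ∧ ∀ x ∈ Icc a b, ∀ y ∈ Icc a x, ‖rightCaputo a b α f x y‖ ≤ B := by
  obtain ⟨B, hB₀, hB⟩ :=
    exists_norm_leftCaputo_le (neg_lt_neg hab) hα (contDiffOn_comp_neg_Icc hf)
  refine ⟨B, hB₀, fun x hx y hy => ?_⟩
  have hbound := hB (-x) ⟨neg_le_neg hx.2, neg_le_neg hx.1⟩ (-y) ⟨neg_le_neg hy.2, neg_le_neg hy.1⟩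
  simpa only [leftCaputo_comp_neg, neg_neg] using hbound

theorem natCeil_eq_one (hα₀ : 0 < α) (hα₁ : α ≤ 1) : ⌈α⌉₊ = 1 :=
  (Nat.ceil_eq_iff one_ne_zero).2 (by simpa using ⟨hα₀, hα₁⟩)

theorem fracIntegral_leftCaputo [CompleteSpace X] (hab : a < b) (hα₀ : 0 < α) (hα : α < ⌈α⌉₊)
    (hf : ContDiffOn ℝ ⌈α⌉₊ f (Icc a b)) {x y : ℝ} (hx : a ≤ x) (hxy : x ≤ y) (hy : y ≤ b) :
    fracIntegral α (leftCaputo a b α f x) x y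
      = fracIntegral ⌈α⌉₊ (iteratedDerivWithin ⌈α⌉₊ f (Icc a b)) x y := by
  have hcont := hf.continuousOn_iteratedDerivWithin le_rfl (uniqueDiffOn_Icc hab)
  rw [leftCaputo_eq_fracIntegral, fracIntegral_fracIntegral hα₀ (sub_pos.2 hα) hxy
    (hcont.mono (Icc_subset_Icc hx hy)), add_sub_cancel]

theorem integral_derivWithin_Icc_of_subinterval [CompleteSpace X] (hf : ContDiffOn ℝ 1 f (Icc a b))
    {x y : ℝ} (hx : a ≤ x) (hxy : x ≤ y) (hy : y ≤ b) :
    ∫ t in x..y, derivWithin f (Icc a b) t = f y - f x := by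
  rcases hxy.eq_or_lt with rfl | hlt
  · simp
  have hsub : Icc x y ⊆ Icc a b := Icc_subset_Icc hx hy
  have hderiv : ContinuousOn (derivWithin f (Icc a b)) (Icc a b) :=
    hf.continuousOn_derivWithin (uniqueDiffOn_Icc (hx.trans_lt (hlt.trans_le hy))) le_rfl
  refine intervalIntegral.integral_eq_sub_of_hasDerivAt_of_le hxy (hf.continuousOn.mono hsub)
    (fun t ht => ?_) ((hderiv.mono hsub).intervalIntegrable_of_Icc hxy)
  exact (hf.differentiableOn one_ne_zero t
    (hsub (Ioo_subset_Icc_self ht))).hasDerivWithinAt.hasDerivAt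
      (Icc_mem_nhds (hx.trans_lt ht.1) (ht.2.trans_le hy))

section OrderLtOne

variable [CompleteSpace X]

theorem fracIntegral_leftCaputo_eq_sub (hab : a < b) (hα₀ : 0 < α) (hα₁ : α < 1)
    (hf : ContDiffOn ℝ 1 f (Icc a b)) {x y : ℝ} (hx : a ≤ x) (hxy : x ≤ y) (hy : y ≤ b) :
    fracIntegral α (leftCaputo a b α f x) x y = f y - f x := by
  have hceil := natCeil_eq_one hα₀ hα₁.le
  rw [fracIntegral_leftCaputo hab hα₀ (by simpa [hceil]) (by simpa [hceil]) hx hxy hy, hceil,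
    Nat.cast_one, fracIntegral_one, iteratedDerivWithin_one,
    integral_derivWithin_Icc_of_subinterval hf hx hxy hy]

theorem norm_sub_le_of_norm_leftCaputo_le (hab : a < b) (hα₀ : 0 < α) (hα₁ : α < 1)
    (hf : ContDiffOn ℝ 1 f (Icc a b)) {x y d C : ℝ} (hx : a ≤ x) (hxy : x ≤ y) (hy : y ≤ b)
    (hd : y - x ≤ d) (hC : ∀ t ∈ Icc x y, ‖leftCaputo a b α f x t‖ ≤ C) :
    ‖f y - f x‖ ≤ C * d ^ α / Real.Gamma (α + 1) := by
  rw [← fracIntegral_leftCaputo_eq_sub hab hα₀ hα₁ hf hx hxy hy]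
  refine (norm_fracIntegral_le hα₀ hxy hC).trans ?_
  have hC₀ : 0 ≤ C := (norm_nonneg _).trans (hC x (left_mem_Icc.2 hxy))
  have : 0 < Real.Gamma (α + 1) := Real.Gamma_pos_of_pos (by linarith)
  have : 0 ≤ y - x := sub_nonneg.2 hxy
  gcongr

theorem norm_sub_le_supNorm_leftCaputo (hab : a < b) (hα₀ : 0 < α) (hα₁ : α < 1)
    (hf : ContDiffOn ℝ 1 f (Icc a b)) {x y : ℝ} (hx : a ≤ x) (hy : y ∈ Icc x b)
    (hbdd : BddAbove (normValues (leftCaputo a b α f x) (Icc x b))) :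
    ‖f y - f x‖
      ≤ supNorm (leftCaputo a b α f x) (Icc x b) * (b - x) ^ α / Real.Gamma (α + 1) :=
  norm_sub_le_of_norm_leftCaputo_le hab hα₀ hα₁ hf hx hy.1 hy.2 (sub_le_sub_right hy.2 x)
    fun _ ht => norm_le_supNorm hbdd ⟨ht.1, ht.2.trans hy.2⟩

theorem norm_sub_le_modulus_leftCaputo (hab : a < b) (hα₀ : 0 < α) (hα₁ : α < 1)
    (hf : ContDiffOn ℝ 1 f (Icc a b)) {x y δ : ℝ} (hx : a ≤ x) (hy : y ∈ Icc x b)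
    (hδ : y - x ≤ δ) (hbdd : BddAbove (oscValues (leftCaputo a b α f x) δ (Icc x b))) :
    ‖f y - f x‖
      ≤ modulus (leftCaputo a b α f x) δ (Icc x b) * δ ^ α / Real.Gamma (α + 1) := by
  refine norm_sub_le_of_norm_leftCaputo_le hab hα₀ hα₁ hf hx hy.1 hy.2 hδ fun t ht => ?_
  rw [← sub_zero (leftCaputo a b α f x t), ← leftCaputo_self (a := a) (b := b) (α := α) (f := f) x]
  refine norm_sub_le_modulus hbdd ⟨ht.1, ht.2.trans hy.2⟩ ⟨le_rfl, hy.1.trans hy.2⟩ ?_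
  rw [abs_of_nonneg (sub_nonneg.2 ht.1)]
  linarith [ht.2]

theorem norm_sub_le_supNorm_rightCaputo (hab : a < b) (hα₀ : 0 < α) (hα₁ : α < 1)
    (hf : ContDiffOn ℝ 1 f (Icc a b)) {x y : ℝ} (hx : x ≤ b) (hy : y ∈ Icc a x)
    (hbdd : BddAbove (normValues (rightCaputo a b α f x) (Icc a x))) :
    ‖f y - f x‖
      ≤ supNorm (rightCaputo a b α f x) (Icc a x) * (x - a) ^ α / Real.Gamma (α + 1) := by
  have hrefl := norm_sub_le_supNorm_leftCaputo (neg_lt_neg hab) hα₀ hα₁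
    (contDiffOn_comp_neg_Icc hf) (neg_le_neg hx) (y := -y) ⟨neg_le_neg hy.2, neg_le_neg hy.1⟩
  simp only [leftCaputo_comp_neg, ← neg_Icc, normValues_comp_neg, supNorm_comp_neg, neg_neg,
    neg_sub_neg] at hrefl
  exact hrefl hbdd

theorem norm_sub_le_modulus_rightCaputo (hab : a < b) (hα₀ : 0 < α) (hα₁ : α < 1)
    (hf : ContDiffOn ℝ 1 f (Icc a b)) {x y δ : ℝ} (hx : x ≤ b) (hy : y ∈ Icc a x)
    (hδ : x - y ≤ δ) (hbdd : BddAbove (oscValues (rightCaputo a b α f x) δ (Icc a x))) :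
    ‖f y - f x‖
      ≤ modulus (rightCaputo a b α f x) δ (Icc a x) * δ ^ α / Real.Gamma (α + 1) := by
  have hrefl := norm_sub_le_modulus_leftCaputo (neg_lt_neg hab) hα₀ hα₁
    (contDiffOn_comp_neg_Icc hf) (δ := δ) (neg_le_neg hx) (y := -y)
    ⟨neg_le_neg hy.2, neg_le_neg hy.1⟩
  simp only [leftCaputo_comp_neg, ← neg_Icc, oscValues_comp_neg, modulus_comp_neg, neg_neg,
    neg_sub_neg] at hrefl
  exact hrefl hδ hbdd

end OrderLtOne

end Caputo

section Sigmoid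

variable {m : ℕ}

theorem one_le_one_add_pow_two_mul (m : ℕ) (x : ℝ) : 1 ≤ 1 + x ^ (2 * m) :=
  le_add_of_nonneg_right ((even_two_mul m).pow_nonneg x)

theorem one_add_pow_two_mul_rpow_pos (m : ℕ) (x r : ℝ) : 0 < (1 + x ^ (2 * m)) ^ r :=
  Real.rpow_pos_of_pos (zero_lt_one.trans_le (one_le_one_add_pow_two_mul m x)) r

theorem pow_two_mul_rpow_one_div (hm : 1 ≤ m) {x : ℝ} (hx : 0 ≤ x) :
    (x ^ (2 * m)) ^ (1 / (2 * (m : ℝ))) = x := by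
  rw [one_div]
  exact_mod_cast Real.pow_rpow_inv_natCast hx (n := 2 * m) (by omega)

theorem sigmoid_neg (m : ℕ) (x : ℝ) : sigmoid m (-x) = -sigmoid m x := by
  rw [sigmoid, sigmoid, (even_two_mul m).neg_pow, neg_div]

theorem sigmoid_le_one (hm : 1 ≤ m) (x : ℝ) : sigmoid m x ≤ 1 := by
  rw [sigmoid, div_le_one (one_add_pow_two_mul_rpow_pos m x _)]
  rcases le_total x 0 with hx | hx
  · exact hx.trans (one_add_pow_two_mul_rpow_pos m x _).le
  · conv_lhs => rw [← pow_two_mul_rpow_one_div hm hx]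
    exact Real.rpow_le_rpow (by positivity) (by linarith) (by positivity)

theorem neg_one_le_sigmoid (hm : 1 ≤ m) (x : ℝ) : -1 ≤ sigmoid m x := by
  rw [← neg_neg x, sigmoid_neg, neg_le_neg_iff]
  exact sigmoid_le_one hm (-x)

theorem sigmoid_monotoneOn (hm : 1 ≤ m) : MonotoneOn (sigmoid m) (Ici 0) := by
  intro x (hx : 0 ≤ x) y (hy : 0 ≤ y) hxy
  have hpow : x ^ (2 * m) ≤ y ^ (2 * m) := pow_le_pow_left₀ hx hxy _
  rw [sigmoid, sigmoid, div_le_div_iff₀ (one_add_pow_two_mul_rpow_pos m x _)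
    (one_add_pow_two_mul_rpow_pos m y _)]
  calc x * (1 + y ^ (2 * m)) ^ (1 / (2 * (m : ℝ)))
      = (x ^ (2 * m) * (1 + y ^ (2 * m))) ^ (1 / (2 * (m : ℝ))) := by
        rw [Real.mul_rpow (by positivity) (by positivity), pow_two_mul_rpow_one_div hm hx]
    _ ≤ (y ^ (2 * m) * (1 + x ^ (2 * m))) ^ (1 / (2 * (m : ℝ))) :=
        Real.rpow_le_rpow (by positivity) (by linarith) (by positivity)
    _ = y * (1 + x ^ (2 * m)) ^ (1 / (2 * (m : ℝ))) := by
        rw [Real.mul_rpow (by positivity) (by positivity), pow_two_mul_rpow_one_div hm hy]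

theorem sigmoid_monotone (hm : 1 ≤ m) : Monotone (sigmoid m) :=
  monotone_of_odd_of_monotoneOn_nonneg (sigmoid_neg m) (sigmoid_monotoneOn hm)

theorem sigmoid_add_le (m : ℕ) {p q : ℝ} (hp : 0 ≤ p) (hq : 0 ≤ q) :
    sigmoid m (p + q) ≤ sigmoid m p + sigmoid m q := by
  have hdenom : ∀ u, 0 ≤ u → u ≤ p + q →
      u / (1 + (p + q) ^ (2 * m)) ^ (1 / (2 * (m : ℝ))) ≤ sigmoid m u := by
    intro u hu hle
    have := one_le_one_add_pow_two_mul m u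
    have := one_add_pow_two_mul_rpow_pos m u (1 / (2 * (m : ℝ)))
    rw [sigmoid]
    gcongr
  rw [sigmoid, add_div]
  exact add_le_add (hdenom p hp (by linarith)) (hdenom q hq (by linarith))

theorem one_sub_sigmoid_le (hm : 1 ≤ m) {s : ℝ} (hs : 0 < s) :
    1 - sigmoid m s ≤ 1 / (2 * m * s ^ (2 * m)) := by
  have hm' : (1 : ℝ) ≤ m := by exact_mod_cast hm
  set u : ℝ := 1 / (2 * m * s ^ (2 * m))
  have hu : 0 < u := by positivity
  have hbernoulli : (1 + (s ^ (2 * m))⁻¹) ^ (1 / (2 * (m : ℝ))) ≤ 1 + u := by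
    refine (rpow_one_add_le_one_add_mul_self ?_ (by positivity) ?_).trans_eq ?_
    · linarith [inv_pos.2 (pow_pos hs (2 * m))]
    · rw [div_le_one (by positivity)]
      linarith
    · simp only [u]
      field_simp
  have hdenom : (1 + s ^ (2 * m)) ^ (1 / (2 * (m : ℝ))) ≤ s * (1 + u) := by
    rw [show 1 + s ^ (2 * m) = s ^ (2 * m) * (1 + (s ^ (2 * m))⁻¹) by field_simp; ring,
      Real.mul_rpow (by positivity) (by positivity), pow_two_mul_rpow_one_div hm hs.le]
    gcongr
  have hsigmoid : 1 / (1 + u) ≤ sigmoid m s := by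
    rw [sigmoid, div_le_div_iff₀ (by positivity) (one_add_pow_two_mul_rpow_pos m s _)]
    linarith
  have hgeom : 1 - u ≤ 1 / (1 + u) := by
    rw [le_div_iff₀ (by positivity)]
    nlinarith
  linarith

end Sigmoid

section Density

variable {m : ℕ}

theorem density_nonneg (hm : 1 ≤ m) (x : ℝ) : 0 ≤ density m x := by
  rw [density]
  linarith [sigmoid_monotone hm (show x - 1 ≤ x + 1 by linarith)]

theorem density_neg (m : ℕ) (x : ℝ) : density m (-x) = density m x := by
  rw [density, density, show -x + 1 = -(x - 1) by ring, show -x - 1 = -(x + 1) by ring, sigmoid_neg,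
    sigmoid_neg]
  ring

theorem le_density_of_abs_le_one (m : ℕ) {y : ℝ} (hy : |y| ≤ 1) :
    (2 * (1 + (4 : ℝ) ^ m) ^ (1 / (2 * (m : ℝ))))⁻¹ ≤ density m y := by
  obtain ⟨hy₁, hy₂⟩ := abs_le.1 hy
  have hsigmoid_two : sigmoid m 2 = 2 / (1 + (4 : ℝ) ^ m) ^ (1 / (2 * (m : ℝ))) := by
    rw [sigmoid, pow_mul]
    norm_num
  calc (2 * (1 + (4 : ℝ) ^ m) ^ (1 / (2 * (m : ℝ))))⁻¹
      = 1 / 4 * sigmoid m ((1 + y) + (1 - y)) := by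
        rw [show (1 + y) + (1 - y) = 2 by ring, hsigmoid_two, mul_inv]
        ring
    _ ≤ 1 / 4 * (sigmoid m (1 + y) + sigmoid m (1 - y)) :=
        mul_le_mul_of_nonneg_left (sigmoid_add_le m (by linarith) (by linarith)) (by norm_num)
    _ = density m y := by
        rw [density, ← neg_sub 1 y, sigmoid_neg, sub_neg_eq_add, add_comm 1 y]

theorem sum_Ico_density (m : ℕ) (z : ℝ) {p q : ℤ} (hpq : p ≤ q) :
    ∑ k ∈ Finset.Ico p q, density m (z - k)
      = (1 / 4) * ((sigmoid m (z - p + 1) + sigmoid m (z - p))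
        - (sigmoid m (z - q + 1) + sigmoid m (z - q))) := by
  induction q, hpq using Int.leInduction with
  | base => simp
  | succ q hpq ih =>
    rw [← Finset.insert_Ico_right_eq_Ico_add_one hpq, Finset.sum_insert Finset.right_notMem_Ico, ih,
      density, show z - ((q + 1 : ℤ) : ℝ) = z - q - 1 by push_cast; ring, sub_add_cancel]
    ring

variable {F : Finset ℤ} {z s : ℝ}

theorem sum_density_le_of_forall_ge (hm : 1 ≤ m) {p : ℤ} (hF : ∀ k ∈ F, p ≤ k) (z : ℝ) :
    ∑ k ∈ F, density m (z - k) ≤ (1 + sigmoid m (z - p + 1)) / 2 := by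
  obtain ⟨q, hq⟩ := F.bddAbove
  set r := max p (q + 1)
  have hsub : F ⊆ Finset.Ico p r := fun k hk =>
    Finset.mem_Ico.2 ⟨hF k hk, (Int.lt_add_one_of_le (hq hk)).trans_le (le_max_right _ _)⟩
  calc ∑ k ∈ F, density m (z - k)
      ≤ ∑ k ∈ Finset.Ico p r, density m (z - k) :=
        Finset.sum_le_sum_of_subset_of_nonneg hsub fun _ _ _ => density_nonneg hm _
    _ = (1 / 4) * ((sigmoid m (z - p + 1) + sigmoid m (z - p))
          - (sigmoid m (z - r + 1) + sigmoid m (z - r))) :=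
        sum_Ico_density m z (le_max_left _ _)
    _ ≤ (1 + sigmoid m (z - p + 1)) / 2 := by
        linarith [sigmoid_monotone hm (show z - p ≤ z - p + 1 by linarith),
          neg_one_le_sigmoid hm (z - r + 1), neg_one_le_sigmoid hm (z - r)]

theorem sum_density_le_one (hm : 1 ≤ m) (F : Finset ℤ) (z : ℝ) :
    ∑ k ∈ F, density m (z - k) ≤ 1 := by
  obtain ⟨p, hp⟩ := F.bddBelow
  linarith [sum_density_le_of_forall_ge hm (fun _ hk => hp hk) z, sigmoid_le_one hm (z - p + 1)]

theorem sum_density_le_of_add_le (hm : 1 ≤ m) (hs : 0 < s) (hF : ∀ k ∈ F, z + (s + 1) ≤ k) :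
    ∑ k ∈ F, density m (z - k) ≤ 1 / (4 * m * s ^ (2 * m)) := by
  set p := ⌈z + (s + 1)⌉
  have hsigmoid : sigmoid m (z - p + 1) ≤ -sigmoid m s := by
    rw [← sigmoid_neg]
    exact sigmoid_monotone hm (by linarith [Int.le_ceil (z + (s + 1))])
  calc ∑ k ∈ F, density m (z - k)
      ≤ (1 + sigmoid m (z - p + 1)) / 2 :=
        sum_density_le_of_forall_ge hm (fun k hk => Int.ceil_le.2 (hF k hk)) z
    _ ≤ (1 - sigmoid m s) / 2 := by linarith
    _ ≤ 1 / (2 * m * s ^ (2 * m)) / 2 := by linarith [one_sub_sigmoid_le hm hs]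
    _ = 1 / (4 * m * s ^ (2 * m)) := by
        rw [div_div]
        ring

theorem sum_density_le_of_le_sub (hm : 1 ≤ m) (hs : 0 < s) (hF : ∀ k ∈ F, k ≤ z - (s + 1)) :
    ∑ k ∈ F, density m (z - k) ≤ 1 / (4 * m * s ^ (2 * m)) := by
  have hrefl := sum_density_le_of_add_le hm hs (F := F.map (Equiv.neg ℤ).toEmbedding) (z := -z)
    (by simpa using fun k hk => by linarith [hF (-k) hk, Int.cast_neg (R := ℝ) k])
  simpa only [Finset.sum_map, Equiv.coe_toEmbedding, Equiv.neg_apply, Int.cast_neg, ← neg_sub',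
    density_neg] using hrefl

theorem exists_abs_sub_intCast_le_one {u v : ℝ} (hz : z ∈ Icc u v) (huv : ⌈u⌉ ≤ ⌊v⌋) :
    ∃ k ∈ Finset.Icc ⌈u⌉ ⌊v⌋, |z - k| ≤ 1 := by
  rcases le_or_gt (⌈u⌉ : ℝ) z with h | h
  · refine ⟨⌊z⌋, Finset.mem_Icc.2 ⟨Int.le_floor.2 h, Int.floor_le_floor hz.2⟩, abs_le.2 ⟨?_, ?_⟩⟩
      <;> linarith [Int.floor_le z, Int.lt_floor_add_one z]
  · refine ⟨⌈u⌉, Finset.left_mem_Icc.2 huv, abs_le.2 ⟨?_, ?_⟩⟩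
      <;> linarith [Int.ceil_lt_add_one u, hz.1]

theorem le_sum_density (hm : 1 ≤ m) {u v : ℝ} (hz : z ∈ Icc u v) (huv : ⌈u⌉ ≤ ⌊v⌋) :
    (2 * (1 + (4 : ℝ) ^ m) ^ (1 / (2 * (m : ℝ))))⁻¹
      ≤ ∑ k ∈ Finset.Icc ⌈u⌉ ⌊v⌋, density m (z - k) := by
  obtain ⟨k, hk, hzk⟩ := exists_abs_sub_intCast_le_one hz huv
  exact (le_density_of_abs_le_one m hzk).trans
    (Finset.single_le_sum (f := fun k : ℤ => density m (z - k))
      (fun _ _ => density_nonneg hm _) hk)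

theorem sum_density_mul_le (hm : 1 ≤ m) (hs : 0 < s) {e : ℤ → ℝ} {E₀ E₁ E₂ : ℝ}
    (hE₀ : 0 ≤ E₀) (hE₁ : 0 ≤ E₁) (hE₂ : 0 ≤ E₂)
    (hnear : ∀ k ∈ F, |k - z| ≤ s + 1 → e k ≤ E₀)
    (hleft : ∀ k ∈ F, k ≤ z - (s + 1) → e k ≤ E₁)
    (hright : ∀ k ∈ F, z + (s + 1) ≤ k → e k ≤ E₂) :
    ∑ k ∈ F, density m (z - k) * e k ≤ E₀ + 1 / (4 * m * s ^ (2 * m)) * (E₁ + E₂) := by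
  set L := F.filter fun k : ℤ => (k : ℝ) ≤ z - (s + 1)
  set R := F.filter fun k : ℤ => z + (s + 1) ≤ k
  have hterm : ∀ k ∈ F, e k ≤ E₀ + ((if (k : ℝ) ≤ z - (s + 1) then E₁ else 0)
      + if z + (s + 1) ≤ k then E₂ else 0) := by
    intro k hk
    split_ifs with hl hr hr
    · linarith [hleft k hk hl]
    · linarith [hleft k hk hl]
    · linarith [hright k hk hr]
    · linarith [hnear k hk (abs_le.2 ⟨by linarith, by linarith⟩)]
  have hL : ∑ k ∈ L, density m (z - k) ≤ 1 / (4 * m * s ^ (2 * m)) :=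
    sum_density_le_of_le_sub hm hs fun k hk => (Finset.mem_filter.1 hk).2
  have hR : ∑ k ∈ R, density m (z - k) ≤ 1 / (4 * m * s ^ (2 * m)) :=
    sum_density_le_of_add_le hm hs fun k hk => (Finset.mem_filter.1 hk).2
  calc ∑ k ∈ F, density m (z - k) * e k
      ≤ ∑ k ∈ F, density m (z - k) * (E₀ + ((if (k : ℝ) ≤ z - (s + 1) then E₁ else 0)
          + if z + (s + 1) ≤ k then E₂ else 0)) :=
        Finset.sum_le_sum fun k hk =>
          mul_le_mul_of_nonneg_left (hterm k hk) (density_nonneg hm _)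
    _ = (∑ k ∈ F, density m (z - k)) * E₀ + ((∑ k ∈ L, density m (z - k)) * E₁
          + (∑ k ∈ R, density m (z - k)) * E₂) := by
        simp only [mul_add, mul_ite, ite_mul, mul_zero, zero_mul, Finset.sum_add_distrib,
          Finset.sum_mul, Finset.sum_filter, L, R]
    _ ≤ 1 * E₀ + (1 / (4 * m * s ^ (2 * m)) * E₁ + 1 / (4 * m * s ^ (2 * m)) * E₂) := by
        have hF := sum_density_le_one hm F z
        gcongr
    _ = E₀ + 1 / (4 * m * s ^ (2 * m)) * (E₁ + E₂) := by ring

end Density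

section Network

variable {a b : ℝ} {m n : ℕ} {f : ℝ → X}

theorem div_natCast_mem_Icc_of_mem_Icc_ceil_floor (hn : 0 < n) {k : ℤ}
    (hk : k ∈ Finset.Icc ⌈(n : ℝ) * a⌉ ⌊(n : ℝ) * b⌋) : (k : ℝ) / n ∈ Icc a b := by
  have hn' : (0 : ℝ) < n := Nat.cast_pos.2 hn
  obtain ⟨hak, hkb⟩ := Finset.mem_Icc.1 hk
  exact ⟨(le_div_iff₀' hn').2 (Int.ceil_le.1 hak), (div_le_iff₀' hn').2 (Int.le_floor.1 hkb)⟩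

theorem netOp_eq_centerMass (m : ℕ) (a b : ℝ) (n : ℕ) (f : ℝ → X) (x : ℝ) :
    netOp m a b n f x = (Finset.Icc ⌈(n : ℝ) * a⌉ ⌊(n : ℝ) * b⌋).centerMass
      (fun k : ℤ => density m (n * x - k)) (fun k : ℤ => f (k / n)) :=
  rfl

theorem norm_netOp_sub_le_mul_sum (hm : 1 ≤ m) (hnab : ⌈(n : ℝ) * a⌉ ≤ ⌊(n : ℝ) * b⌋) {x : ℝ}
    (hx : x ∈ Icc a b) (v : X) :
    ‖netOp m a b n f x - v‖ ≤ 2 * (1 + (4 : ℝ) ^ m) ^ (1 / (2 * (m : ℝ))) *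
      ∑ k ∈ Finset.Icc ⌈(n : ℝ) * a⌉ ⌊(n : ℝ) * b⌋,
        density m (n * x - k) * ‖f (k / n) - v‖ := by
  have hc : 0 < 2 * (1 + (4 : ℝ) ^ m) ^ (1 / (2 * (m : ℝ))) := by positivity
  have hmass := le_sum_density hm (z := n * x) ⟨by gcongr; exact hx.1, by gcongr; exact hx.2⟩ hnab
  have hjensen := (convexOn_dist v convex_univ).map_centerMass_le
    (t := Finset.Icc ⌈(n : ℝ) * a⌉ ⌊(n : ℝ) * b⌋) (w := fun k : ℤ => density m (n * x - k))
    (p := fun k : ℤ => f (k / n)) (fun _ _ => density_nonneg hm _)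
    ((inv_pos.2 hc).trans_le hmass) (fun _ _ => mem_univ _)
  simp only [dist_eq_norm, ← netOp_eq_centerMass] at hjensen
  refine hjensen.trans (mul_le_mul_of_nonneg_right (inv_le_of_inv_le₀ hc hmass) ?_)
  exact Finset.sum_nonneg fun k _ => mul_nonneg (density_nonneg hm _) (norm_nonneg _)

theorem norm_netOp_sub_le (hm : 1 ≤ m) (hnab : ⌈(n : ℝ) * a⌉ ≤ ⌊(n : ℝ) * b⌋)
    {x : ℝ} (hx : x ∈ Icc a b) {δ s : ℝ} (hs : 0 < s) (hsδ : s + 1 ≤ n * δ) {v : X} {E₀ E₁ E₂ : ℝ}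
    (hE₀ : 0 ≤ E₀) (hE₁ : 0 ≤ E₁) (hE₂ : 0 ≤ E₂)
    (hnear : ∀ y ∈ Icc a b, |y - x| ≤ δ → ‖f y - v‖ ≤ E₀)
    (hleft : ∀ y ∈ Icc a x, ‖f y - v‖ ≤ E₁) (hright : ∀ y ∈ Icc x b, ‖f y - v‖ ≤ E₂) :
    ‖netOp m a b n f x - v‖ ≤ 2 * (1 + (4 : ℝ) ^ m) ^ (1 / (2 * (m : ℝ))) *
      (E₀ + 1 / (4 * m * s ^ (2 * m)) * (E₁ + E₂)) := by
  have hδ : 0 < δ := pos_of_mul_pos_right (by linarith : 0 < n * δ) n.cast_nonneg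
  have hn : (0 : ℝ) < n := pos_of_mul_pos_left (by linarith) hδ.le
  refine (norm_netOp_sub_le_mul_sum hm hnab hx v).trans ?_
  refine mul_le_mul_of_nonneg_left ?_ (by positivity)
  refine sum_density_mul_le hm hs hE₀ hE₁ hE₂ (fun k hk hkx => ?_) (fun k hk hkx => ?_)
    fun k hk hkx => ?_
  all_goals have hnode := div_natCast_mem_Icc_of_mem_Icc_ceil_floor (Nat.cast_pos.1 hn) hk
  · refine hnear _ hnode ?_
    rw [div_sub' hn.ne', abs_div, abs_of_pos hn, div_le_iff₀' hn]
    exact hkx.trans hsδ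
  · exact hleft _ ⟨hnode.1, (div_le_iff₀' hn).2 (by linarith)⟩
  · exact hright _ ⟨(le_div_iff₀' hn).2 (by linarith), hnode.2⟩

end Network

theorem one_div_rpow_rpow {r : ℝ} (hr : 0 ≤ r) (α β : ℝ) :
    (1 / r ^ β) ^ α = 1 / r ^ (α * β) := by
  rw [Real.div_rpow zero_le_one (Real.rpow_nonneg hr β), Real.one_rpow, ← Real.rpow_mul hr,
    mul_comm]

section Error

variable {a b α δ s : ℝ} {f : ℝ → X} {m n : ℕ}

theorem bddAbove_image_supNorm {E : Type*} [NormedAddCommGroup E] {T : Set ℝ} {g : ℝ → ℝ → E}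
    {S : ℝ → Set ℝ} {B : ℝ} (hB₀ : 0 ≤ B) (hB : ∀ x ∈ T, ∀ y ∈ S x, ‖g x y‖ ≤ B) :
    BddAbove ((fun x => supNorm (g x) (S x)) '' T) :=
  ⟨B, forall_mem_image.2 fun x hx => supNorm_le hB₀ (hB x hx)⟩

theorem bddAbove_image_modulus {E : Type*} [NormedAddCommGroup E] {T : Set ℝ} {g : ℝ → ℝ → E}
    {S : ℝ → Set ℝ} {B : ℝ} (hB₀ : 0 ≤ B) (hB : ∀ x ∈ T, ∀ y ∈ S x, ‖g x y‖ ≤ B) :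
    BddAbove ((fun x => modulus (g x) δ (S x)) '' T) :=
  ⟨B + B, forall_mem_image.2 fun x hx => modulus_le hB₀ (hB x hx)⟩

theorem exists_norm_caputo_le_of_lt_one (hab : a < b) (hα₀ : 0 < α) (hα₁ : α < 1)
    (hf : ContDiffOn ℝ 1 f (Icc a b)) :
    ∃ B, 0 ≤ B ∧ (∀ x ∈ Icc a b, ∀ y ∈ Icc a x, ‖rightCaputo a b α f x y‖ ≤ B) ∧
      ∀ x ∈ Icc a b, ∀ y ∈ Icc x b, ‖leftCaputo a b α f x y‖ ≤ B := by
  have hceil := natCeil_eq_one hα₀ hα₁.le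
  have hα : α < ⌈α⌉₊ := by rwa [hceil, Nat.cast_one]
  have hf' : ContDiffOn ℝ ⌈α⌉₊ f (Icc a b) := by rwa [hceil, Nat.cast_one]
  obtain ⟨Br, hBr₀, hBr⟩ := exists_norm_rightCaputo_le hab hα hf'
  obtain ⟨Bl, -, hBl⟩ := exists_norm_leftCaputo_le hab hα hf'
  exact ⟨max Br Bl, hBr₀.trans (le_max_left _ _),
    fun x hx y hy => (hBr x hx y hy).trans (le_max_left _ _),
    fun x hx y hy => (hBl x hx y hy).trans (le_max_right _ _)⟩

variable [CompleteSpace X]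

theorem norm_netOp_sub_le_caputo (hab : a < b) (hα₀ : 0 < α) (hα₁ : α < 1)
    (hf : ContDiffOn ℝ 1 f (Icc a b)) (hm : 1 ≤ m)
    (hnab : ⌈(n : ℝ) * a⌉ ≤ ⌊(n : ℝ) * b⌋) (hs : 0 < s) (hsδ : s + 1 ≤ n * δ) {x : ℝ}
    (hx : x ∈ Icc a b) :
    ‖netOp m a b n f x - f x‖ ≤
      2 * (1 + (4 : ℝ) ^ m) ^ (1 / (2 * (m : ℝ))) / Real.Gamma (α + 1) *
        ((modulus (rightCaputo a b α f x) δ (Icc a x)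
            + modulus (leftCaputo a b α f x) δ (Icc x b)) * δ ^ α
          + 1 / (4 * (m : ℝ) * s ^ (2 * m)) *
            (supNorm (rightCaputo a b α f x) (Icc a x) * (x - a) ^ α
              + supNorm (leftCaputo a b α f x) (Icc x b) * (b - x) ^ α)) := by
  have : 0 < Real.Gamma (α + 1) := Real.Gamma_pos_of_pos (by linarith)
  have : 0 ≤ x - a := sub_nonneg.2 hx.1
  have : 0 ≤ b - x := sub_nonneg.2 hx.2
  have : 0 < δ := pos_of_mul_pos_right (by linarith : 0 < n * δ) n.cast_nonneg
  have hΩr := modulus_nonneg (rightCaputo a b α f x) δ (Icc a x)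
  have hΩl := modulus_nonneg (leftCaputo a b α f x) δ (Icc x b)
  have := supNorm_nonneg (rightCaputo a b α f x) (Icc a x)
  have := supNorm_nonneg (leftCaputo a b α f x) (Icc x b)
  obtain ⟨B, -, hBr, hBl⟩ := exists_norm_caputo_le_of_lt_one hab hα₀ hα₁ hf
  refine (norm_netOp_sub_le hm hnab hx hs hsδ
    (E₀ := (modulus (rightCaputo a b α f x) δ (Icc a x)
      + modulus (leftCaputo a b α f x) δ (Icc x b)) * δ ^ α / Real.Gamma (α + 1))
    (by positivity) (by positivity) (by positivity) (fun y hy hyx => ?_)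
    (fun y hy => norm_sub_le_supNorm_rightCaputo hab hα₀ hα₁ hf hx.2 hy
      (bddAbove_normValues (hBr x hx)))
    (fun y hy => norm_sub_le_supNorm_leftCaputo hab hα₀ hα₁ hf hx.1 hy
      (bddAbove_normValues (hBl x hx)))).trans_eq (by ring)
  obtain ⟨hxy, hyx⟩ := abs_le.1 hyx
  rcases le_total y x with hle | hle
  · refine (norm_sub_le_modulus_rightCaputo hab hα₀ hα₁ hf hx.2 ⟨hy.1, hle⟩
      (show x - y ≤ δ by linarith)
      (bddAbove_oscValues (hBr x hx))).trans ?_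
    gcongr
    exact le_add_of_nonneg_right hΩl
  · refine (norm_sub_le_modulus_leftCaputo hab hα₀ hα₁ hf hx.1 ⟨hle, hy.2⟩ hyx
      (bddAbove_oscValues (hBl x hx))).trans ?_
    gcongr
    exact le_add_of_nonneg_left hΩr

theorem norm_netOp_sub_le_of_caputo_le (hab : a < b) (hα₀ : 0 < α) (hα₁ : α < 1)
    (hf : ContDiffOn ℝ 1 f (Icc a b)) (hm : 1 ≤ m)
    (hnab : ⌈(n : ℝ) * a⌉ ≤ ⌊(n : ℝ) * b⌋) (hs : 0 < s) (hsδ : s + 1 ≤ n * δ) {x : ℝ}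
    (hx : x ∈ Icc a b) {Ωr Ωl Nr Nl : ℝ}
    (hΩr : modulus (rightCaputo a b α f x) δ (Icc a x) ≤ Ωr)
    (hΩl : modulus (leftCaputo a b α f x) δ (Icc x b) ≤ Ωl)
    (hNr : supNorm (rightCaputo a b α f x) (Icc a x) ≤ Nr)
    (hNl : supNorm (leftCaputo a b α f x) (Icc x b) ≤ Nl) :
    ‖netOp m a b n f x - f x‖ ≤
      2 * (1 + (4 : ℝ) ^ m) ^ (1 / (2 * (m : ℝ))) / Real.Gamma (α + 1) *
        ((Ωr + Ωl) * δ ^ α + (b - a) ^ α / (4 * (m : ℝ) * s ^ (2 * m)) * (Nr + Nl)) := by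
  have : 0 < Real.Gamma (α + 1) := Real.Gamma_pos_of_pos (by linarith)
  have hxa : 0 ≤ x - a := sub_nonneg.2 hx.1
  have hbx : 0 ≤ b - x := sub_nonneg.2 hx.2
  have : 0 < δ := pos_of_mul_pos_right (by linarith : 0 < n * δ) n.cast_nonneg
  have hNr₀ := (supNorm_nonneg _ _).trans hNr
  have hNl₀ := (supNorm_nonneg _ _).trans hNl
  calc ‖netOp m a b n f x - f x‖
    _ ≤ 2 * (1 + (4 : ℝ) ^ m) ^ (1 / (2 * (m : ℝ))) / Real.Gamma (α + 1) *
          ((Ωr + Ωl) * δ ^ α + 1 / (4 * (m : ℝ) * s ^ (2 * m)) *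
            (Nr * (b - a) ^ α + Nl * (b - a) ^ α)) := by
        refine (norm_netOp_sub_le_caputo hab hα₀ hα₁ hf hm hnab hs hsδ hx).trans ?_
        gcongr
        exacts [hx.2, hx.1]
    _ = _ := by ring

end Error

end AlgNN

theorem theorem31_general {X : Type*} [NormedAddCommGroup X] [NormedSpace ℝ X] [CompleteSpace X]
    (a b : ℝ) (hab : a < b) (α : ℝ) (hα0 : 0 < α) (hα1 : α < 1)
    (f : ℝ → X) (hf : ContDiffOn ℝ 1 f (Set.Icc a b))
    (m : ℕ) (hm : 1 ≤ m) (n : ℕ) (hnab : ⌈(n : ℝ) * a⌉ ≤ ⌊(n : ℝ) * b⌋)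
    (δ s : ℝ) (hs : 0 < s) (hsδ : s + 1 ≤ n * δ) :
    (∀ x ∈ Set.Icc a b,
      BddAbove (oscValues (rightCaputo a b α f x) δ (Set.Icc a x)) ∧
      BddAbove (oscValues (leftCaputo a b α f x) δ (Set.Icc x b)) ∧
      BddAbove (normValues (rightCaputo a b α f x) (Set.Icc a x)) ∧
      BddAbove (normValues (leftCaputo a b α f x) (Set.Icc x b)) ∧
      ‖netOp m a b n f x - f x‖ ≤
        2 * (1 + (4 : ℝ) ^ m) ^ (1 / (2 * (m : ℝ))) / Real.Gamma (α + 1) *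
          ((modulus (rightCaputo a b α f x) δ (Set.Icc a x)
              + modulus (leftCaputo a b α f x) δ (Set.Icc x b)) * δ ^ α
            + 1 / (4 * (m : ℝ) * s ^ (2 * m)) *
              (supNorm (rightCaputo a b α f x) (Set.Icc a x) * (x - a) ^ α
                + supNorm (leftCaputo a b α f x) (Set.Icc x b) * (b - x) ^ α))) ∧
    (BddAbove ((fun x => modulus (rightCaputo a b α f x) δ (Set.Icc a x)) '' Set.Icc a b) ∧
      BddAbove ((fun x => modulus (leftCaputo a b α f x) δ (Set.Icc x b)) '' Set.Icc a b) ∧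
      BddAbove ((fun x => supNorm (rightCaputo a b α f x) (Set.Icc a x)) '' Set.Icc a b) ∧
      BddAbove ((fun x => supNorm (leftCaputo a b α f x) (Set.Icc x b)) '' Set.Icc a b) ∧
      BddAbove (normValues (fun x => netOp m a b n f x - f x) (Set.Icc a b)) ∧
      supNorm (fun x => netOp m a b n f x - f x) (Set.Icc a b) ≤
        2 * (1 + (4 : ℝ) ^ m) ^ (1 / (2 * (m : ℝ))) / Real.Gamma (α + 1) *
          ((sSup ((fun x => modulus (rightCaputo a b α f x) δ (Set.Icc a x)) '' Set.Icc a b)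
              + sSup ((fun x => modulus (leftCaputo a b α f x) δ (Set.Icc x b)) '' Set.Icc a b))
              * δ ^ α
            + (b - a) ^ α / (4 * (m : ℝ) * s ^ (2 * m)) *
              (sSup ((fun x => supNorm (rightCaputo a b α f x) (Set.Icc a x)) '' Set.Icc a b)
                + sSup ((fun x => supNorm (leftCaputo a b α f x) (Set.Icc x b)) ''
                  Set.Icc a b)))) := by
  obtain ⟨B, hB₀, hBr, hBl⟩ := exists_norm_caputo_le_of_lt_one hab hα0 hα1 hf
  have hΩr := bddAbove_image_modulus (δ := δ) hB₀ hBr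
  have hΩl := bddAbove_image_modulus (δ := δ) hB₀ hBl
  have hNr := bddAbove_image_supNorm hB₀ hBr
  have hNl := bddAbove_image_supNorm hB₀ hBl
  have hunif := fun x (hx : x ∈ Set.Icc a b) =>
    norm_netOp_sub_le_of_caputo_le hab hα0 hα1 hf hm hnab hs hsδ hx
      (le_csSup hΩr (Set.mem_image_of_mem _ hx)) (le_csSup hΩl (Set.mem_image_of_mem _ hx))
      (le_csSup hNr (Set.mem_image_of_mem _ hx)) (le_csSup hNl (Set.mem_image_of_mem _ hx))
  have hpointwise := fun x (hx : x ∈ Set.Icc a b) =>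
    norm_netOp_sub_le_caputo hab hα0 hα1 hf hm hnab hs hsδ hx
  exact ⟨fun x hx => ⟨bddAbove_oscValues (hBr x hx), bddAbove_oscValues (hBl x hx),
      bddAbove_normValues (hBr x hx), bddAbove_normValues (hBl x hx), hpointwise x hx⟩,
    hΩr, hΩl, hNr, hNl, bddAbove_normValues hunif,
    supNorm_le ((norm_nonneg _).trans (hunif a (Set.left_mem_Icc.2 hab.le))) hunif⟩

theorem theorem31 {X : Type*} [NormedAddCommGroup X] [NormedSpace ℝ X] [CompleteSpace X]
    (a b : ℝ) (hab : a < b) (α β : ℝ) (hα0 : 0 < α) (hα1 : α < 1) (hβ0 : 0 < β) (hβ1 : β < 1)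
    (f : ℝ → X) (hf : ContDiffOn ℝ 1 f (Set.Icc a b))
    (m : ℕ) (hm : 1 ≤ m) (n : ℕ) (hn : 2 < (n : ℝ) ^ (1 - β))
    (hnab : ⌈(n : ℝ) * a⌉ ≤ ⌊(n : ℝ) * b⌋) :
    -- pointwise bound; the suprema in it are finite
    (∀ x ∈ Set.Icc a b,
      BddAbove (oscValues (rightCaputo a b α f x) (1 / (n : ℝ) ^ β) (Set.Icc a x)) ∧
      BddAbove (oscValues (leftCaputo a b α f x) (1 / (n : ℝ) ^ β) (Set.Icc x b)) ∧
      BddAbove (normValues (rightCaputo a b α f x) (Set.Icc a x)) ∧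
      BddAbove (normValues (leftCaputo a b α f x) (Set.Icc x b)) ∧
      ‖netOp m a b n f x - f x‖ ≤
        2 * (1 + (4 : ℝ) ^ m) ^ (1 / (2 * (m : ℝ))) / Real.Gamma (α + 1) *
          ((modulus (rightCaputo a b α f x) (1 / (n : ℝ) ^ β) (Set.Icc a x)
              + modulus (leftCaputo a b α f x) (1 / (n : ℝ) ^ β) (Set.Icc x b))
                / (n : ℝ) ^ (α * β)
            + 1 / (4 * (m : ℝ) * ((n : ℝ) ^ (1 - β) - 2) ^ (2 * m)) *
              (supNorm (rightCaputo a b α f x) (Set.Icc a x) * (x - a) ^ α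
                + supNorm (leftCaputo a b α f x) (Set.Icc x b) * (b - x) ^ α))) ∧
    -- uniform bound; the suprema in it are finite
    (BddAbove ((fun x => modulus (rightCaputo a b α f x) (1 / (n : ℝ) ^ β) (Set.Icc a x)) ''
        Set.Icc a b) ∧
      BddAbove ((fun x => modulus (leftCaputo a b α f x) (1 / (n : ℝ) ^ β) (Set.Icc x b)) ''
        Set.Icc a b) ∧
      BddAbove ((fun x => supNorm (rightCaputo a b α f x) (Set.Icc a x)) '' Set.Icc a b) ∧
      BddAbove ((fun x => supNorm (leftCaputo a b α f x) (Set.Icc x b)) '' Set.Icc a b) ∧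
      BddAbove (normValues (fun x => netOp m a b n f x - f x) (Set.Icc a b)) ∧
      supNorm (fun x => netOp m a b n f x - f x) (Set.Icc a b) ≤
        2 * (1 + (4 : ℝ) ^ m) ^ (1 / (2 * (m : ℝ))) / Real.Gamma (α + 1) *
          ((sSup ((fun x => modulus (rightCaputo a b α f x) (1 / (n : ℝ) ^ β) (Set.Icc a x)) ''
                Set.Icc a b)
              + sSup ((fun x => modulus (leftCaputo a b α f x) (1 / (n : ℝ) ^ β) (Set.Icc x b)) ''
                Set.Icc a b))
                / (n : ℝ) ^ (α * β)
            + (b - a) ^ α / (4 * (m : ℝ) * ((n : ℝ) ^ (1 - β) - 2) ^ (2 * m)) *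
              (sSup ((fun x => supNorm (rightCaputo a b α f x) (Set.Icc a x)) '' Set.Icc a b)
                + sSup ((fun x => supNorm (leftCaputo a b α f x) (Set.Icc x b)) ''
                  Set.Icc a b)))) := by
  simpa only [one_div_rpow_rpow n.cast_nonneg, mul_one_div] using
    theorem31_general a b hab α hα0 hα1 f hf m hm n hnab (1 / (n : ℝ) ^ β) ((n : ℝ) ^ (1 - β) - 2)
      (sub_pos.2 hn) (by rw [mul_one_div, ← Real.rpow_one_sub' n.cast_nonneg] <;> linarith)
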